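/- Consider a multi-user MIMO downlink with $K$ users, $N_t$ transmit antennas, $N_r$ receive antennas and $N_s\ge 1$ streams per user. User $k$ has channel $\mathbf H_k\in\mathbb C^{N_t\times N_r}$ (not all $\mathbf H_k$ zero) and receives $\mathbf y_k=\mathbf H_k^H\sum_{i=1}^K\mathbf F_i\mathbf s_i+\mathbf n_k$, where the data vectors $\mathbf s_i$ are uncorrelated across users and with the noise, $\mathbb E[\mathbf s_i\mathbf s_i^H]=\mathbf I_{N_s}$, and $\mathbf n_k\sim\mathcal{CN}(\mathbf 0,\sigma_k^2\mathbf I_{N_r})$ with $\sigma_k>0$. Let $\mathcal E_s>0$ and let $\mathbf F_1,\dots,\mathbf F_K\in\mathbb C^{N_t\times N_s}$ maximize the sum-rate $\sum_{k=1}^K\log_2\det\big(\mathbf I_{N_s}+\mathbf F_k^H\mathbf H_k\mathbf C_k^{-1}\mathbf H_k^H\mathbf F_k\big)$, where $\mathbf C_k=\sigma_k^2\mathbf I_{N_r}+\sum_{i\neq k}\mathbf H_k^H\mathbf F_i\mathbf F_i^H\mathbf H_k$, subject to the total power constraint $\sum_{k=1}^K\mathrm{Tr}(\mathbf F_k\mathbf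 F_k^H)\le\mathcal E_s$. Then $\mathbf F$ has the form "LMMSE with reweighting": there are receivers $\mathbf W_k\in\mathbb C^{N_s\times N_r}$, Hermitian positive definite weight matrices $\mathbf Q_k\in\mathbb C^{N_s\times N_s}$ and a scalar $\gamma>0$ such that, for every $k$, $$\mathbf F_k=\gamma\Big[\sum_{m=1}^K\big(\beta_m\mathbf I_{N_t}+\mathbf H_m\mathbf W_m^H\mathbf Q_m\mathbf W_m\mathbf H_m^H\big)\Big]^{-1}\mathbf H_k\mathbf W_k^H\mathbf Q_k=\gamma\Big[\beta\mathbf I_{N_t}+\sum_{m=1}^K\mathbf H_m\mathbf W_m^H\mathbf Q_m\mathbf W_m\mathbf H_m^H\Big]^{-1}\mathbf H_k\mathbf W_k^H\mathbf Q_k,$$ where $\beta_m=\frac{\sigma_m^2}{\mathcal E_s}\mathrm{Tr}(\mathbf W_m^H\mathbf Q_m\mathbf W_m)$, $\beta=\sum_{m=1}^K\beta_m>0$, the matrix in brackets is positive definite, and $\gamma$ normalizes the power, $\sum_{k=1}^K\mathrm{Tr}(\mathbf F_k\mathbf F_k^H)=\mathcal E_s$. Here $\mathbf W_k$ can be taken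 to be the LMMSE receiver of user $k$, i.e. the minimizer of $\mathbb E\|\mathbf V\mathbf y_k-\mathbf s_k\|^2$ over $\mathbf V\in\mathbb C^{N_s\times N_r}$, and simultaneously $\mathbf Q_k$ to be the inverse of the resulting error covariance matrix $\mathbb E[(\mathbf W_k\mathbf y_k-\mathbf s_k)(\mathbf W_k\mathbf y_k-\mathbf s_k)^H]$. -/

import Mathlib

open scoped Matrix ComplexOrder

noncomputable section

namespace MUMIMO

variable {K Nt Nr Ns : ℕ}

/-- Noise-plus-interference covariance at user `k` for the received signal
`y_k = H_kᴴ ∑ i, F_i s_i + n_k`, where the data vectors `s_i` are uncorrelated across users with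
identity covariance and `n_k` has covariance `σ_k² I`:
`σ_k² I + ∑_{i ≠ k} H_kᴴ F_i F_iᴴ H_k`. -/
def noiseCov (H : Fin K → Matrix (Fin Nt) (Fin Nr) ℂ) (σ : Fin K → ℝ)
    (F : Fin K → Matrix (Fin Nt) (Fin Ns) ℂ) (k : Fin K) : Matrix (Fin Nr) (Fin Nr) ℂ :=
  (((σ k) ^ 2 : ℝ) : ℂ) • (1 : Matrix (Fin Nr) (Fin Nr) ℂ)
    + ∑ i ∈ Finset.univ.erase k, (H k)ᴴ * F i * (F i)ᴴ * H k

/-- Achievable rate of user `k`: `log₂ det (I + F_kᴴ H_k C_k⁻¹ H_kᴴ F_k)`.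
The determinant is a positive real number when `σ_k ≠ 0`. -/
def rate (H : Fin K → Matrix (Fin Nt) (Fin Nr) ℂ) (σ : Fin K → ℝ)
    (F : Fin K → Matrix (Fin Nt) (Fin Ns) ℂ) (k : Fin K) : ℝ :=
  Real.logb 2
    (Matrix.det (1 + (F k)ᴴ * H k * (noiseCov H σ F k)⁻¹ * (H k)ᴴ * F k)).re

/-- The sum-rate of the linear precoders `F`. -/
def sumRate (H : Fin K → Matrix (Fin Nt) (Fin Nr) ℂ) (σ : Fin K → ℝ)
    (F : Fin K → Matrix (Fin Nt) (Fin Ns) ℂ) : ℝ :=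
  ∑ k, rate H σ F k

/-- Total transmit power `∑ k, Tr (F_k F_kᴴ)`. -/
def totalPower (F : Fin K → Matrix (Fin Nt) (Fin Ns) ℂ) : ℝ :=
  ∑ k, (Matrix.trace (F k * (F k)ᴴ)).re

/-- `F` maximizes the sum-rate among all linear precoders of total power at most `Es`. -/
def IsOptimalPrecoder (H : Fin K → Matrix (Fin Nt) (Fin Nr) ℂ) (σ : Fin K → ℝ) (Es : ℝ)
    (F : Fin K → Matrix (Fin Nt) (Fin Ns) ℂ) : Prop :=
  totalPower F ≤ Es ∧
    ∀ F' : Fin K → Matrix (Fin Nt) (Fin Ns) ℂ, totalPower F' ≤ Es →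
      sumRate H σ F' ≤ sumRate H σ F

/-- Error covariance `𝔼[(V y_k - s_k) (V y_k - s_k)ᴴ]` of the linear receiver `V` at user `k`:
`(I - V H_kᴴ F_k) (I - V H_kᴴ F_k)ᴴ + V C_k Vᴴ`. -/
def mseMatrix (H : Fin K → Matrix (Fin Nt) (Fin Nr) ℂ) (σ : Fin K → ℝ)
    (F : Fin K → Matrix (Fin Nt) (Fin Ns) ℂ) (k : Fin K) (V : Matrix (Fin Ns) (Fin Nr) ℂ) :
    Matrix (Fin Ns) (Fin Ns) ℂ :=
  (1 - V * (H k)ᴴ * F k) * (1 - V * (H k)ᴴ * F k)ᴴ + V * noiseCov H σ F k * Vᴴ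

/-- `W` is the LMMSE receiver of user `k`: among all linear receivers it minimizes the
mean square error `𝔼 ‖V y_k - s_k‖²`. -/
def IsLMMSEReceiver (H : Fin K → Matrix (Fin Nt) (Fin Nr) ℂ) (σ : Fin K → ℝ)
    (F : Fin K → Matrix (Fin Nt) (Fin Ns) ℂ) (k : Fin K) (W : Matrix (Fin Ns) (Fin Nr) ℂ) :
    Prop :=
  ∀ V : Matrix (Fin Ns) (Fin Nr) ℂ,
    (Matrix.trace (mseMatrix H σ F k W)).re ≤ (Matrix.trace (mseMatrix H σ F k V)).re

/-- `β_m = (σ_m² / Es) Tr (W_mᴴ Q_m W_m)`; the trace is real for Hermitian `Q_m`. -/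
def regCoeff (σ : Fin K → ℝ) (Es : ℝ) (W : Fin K → Matrix (Fin Ns) (Fin Nr) ℂ)
    (Q : Fin K → Matrix (Fin Ns) (Fin Ns) ℂ) (m : Fin K) : ℝ :=
  (σ m) ^ 2 / Es * (Matrix.trace ((W m)ᴴ * Q m * W m)).re

end MUMIMO

end

open MUMIMO

/-!
The rate of user `k` dominates a quadratic function of the precoder. For every receiver `V` and
every positive definite weight `Q`, with `E_k(V)` the error covariance,
`rate_k * log 2 ≥ log det Q + Ns - Tr (Q E_k(V))`, with equality when `V` is the LMMSE receiver and
`Q` the inverse of its error covariance (`log_re_det_sub_le`, `rateMatrix_mul_mseMatrix`). This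
combines `log det P ≤ Tr P - Ns` with the completed square `mseMatrix_eq_add`.

Let `F` be optimal, `W_k` its LMMSE receivers and `Q_k` the inverse error covariances. With these
weights frozen, the total weighted error `∑ k, Tr (Q_k E_k(V_k))` over all admissible precoders and
all receivers is then minimal at `F`, `W` (`IsOptimalPrecoder.le_sum_re_trace`). The
power constraint needs no Lagrange multiplier: an arbitrary precoder `F' = c F''` with `F''`
admissible, paired with the receivers `c W_k`, has weighted error
`const - 2 Re ∑ Tr (F'_kᴴ G_k) + ∑ Tr (F'_kᴴ (β I + M) F'_k)`, where `G_k = H_k W_kᴴ Q_k`,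
`M = ∑ m, H_m W_mᴴ Q_m W_m H_mᴴ` and `c² Es` is the power of `F'`; the noise contributes the `β`
term because it is scaled by `c²` (`IsOptimalPrecoder.le_quadratic`).

Comparing this bound with its value at `F` gives `(Es - totalPower F) * β ≤ 0`, so all power is used
because `β > 0`. Hence `F` is an unconstrained minimizer of the quadratic function, and its
stationarity `(β I + M) F_k = G_k` (`IsOptimalPrecoder.normal_equation`) is the claimed formula with
`γ = 1`. Positivity of `β` holds because vanishing receivers would mean zero rates, whereas some
nonzero channel can be put to use (`IsOptimalPrecoder.exists_lmmse_ne_zero`).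
-/

noncomputable section

namespace MUMIMO

/-! ### Positive definite matrices -/

section Matrices

variable {m n : Type*} [Fintype m] [Fintype n]

theorem re_trace_conjTranspose (X : Matrix n n ℂ) : Xᴴ.trace.re = X.trace.re := by
  rw [Matrix.trace_conjTranspose, RCLike.star_def, Complex.conj_re]

theorem re_trace_conjTranspose_mul_self_nonneg (X : Matrix m n ℂ) : 0 ≤ (Xᴴ * X).trace.re :=
  (Complex.nonneg_iff.1 (Matrix.posSemidef_conjTranspose_mul_self X).trace_nonneg).1

theorem eq_zero_of_re_trace_conjTranspose_mul_self {X : Matrix m n ℂ}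
    (h : (Xᴴ * X).trace.re = 0) : X = 0 := by
  rw [← Matrix.trace_conjTranspose_mul_self_eq_zero_iff]
  exact Complex.ext h
    (Complex.nonneg_iff.1 (Matrix.posSemidef_conjTranspose_mul_self X).trace_nonneg).2.symm

variable [DecidableEq n]

open scoped MatrixOrder in
theorem exists_eq_conjTranspose_mul_self {Q : Matrix n n ℂ} (hQ : Q.PosSemidef) :
    ∃ B : Matrix n n ℂ, Q = Bᴴ * B := by
  refine ⟨CFC.sqrt Q, ?_⟩
  have h0 : (CFC.sqrt Q)ᴴ = CFC.sqrt Q :=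
    (Matrix.nonneg_iff_posSemidef.1 (CFC.sqrt_nonneg Q)).isHermitian.eq
  rw [h0, CFC.sqrt_mul_sqrt_self Q (Matrix.nonneg_iff_posSemidef.2 hQ)]

theorem exists_isUnit_eq_conjTranspose_mul_self {Q : Matrix n n ℂ} (hQ : Q.PosDef) :
    ∃ B : Matrix n n ℂ, IsUnit B ∧ Q = Bᴴ * B := by
  obtain ⟨B, hB⟩ := exists_eq_conjTranspose_mul_self hQ.posSemidef
  have h := hQ.isUnit
  rw [hB] at h
  exact ⟨B, isUnit_of_mul_isUnit_right h, hB⟩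

theorem re_trace_mul_nonneg {Q P : Matrix n n ℂ} (hQ : Q.PosSemidef) (hP : P.PosSemidef) :
    0 ≤ (Q * P).trace.re := by
  obtain ⟨B, rfl⟩ := exists_eq_conjTranspose_mul_self hQ
  rw [Matrix.mul_assoc, Matrix.trace_mul_comm]
  exact (Complex.nonneg_iff.1 (hP.mul_mul_conjTranspose_same B).trace_nonneg).1

theorem log_re_det_le {P : Matrix n n ℂ} (hP : P.PosDef) :
    Real.log P.det.re ≤ P.trace.re - Fintype.card n := by
  have hdet : P.det.re = ∏ i, hP.1.eigenvalues i := by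
    rw [hP.1.det_eq_prod_eigenvalues]
    simp [← Complex.ofReal_prod]
  have htr : P.trace.re = ∑ i, hP.1.eigenvalues i := by
    rw [hP.1.trace_eq_sum_eigenvalues]
    simp
  rw [hdet, htr, Real.log_prod fun i _ => (hP.eigenvalues_pos i).ne']
  calc ∑ i, Real.log (hP.1.eigenvalues i) ≤ ∑ i, (hP.1.eigenvalues i - 1) :=
        Finset.sum_le_sum fun i _ => Real.log_le_sub_one_of_pos (hP.eigenvalues_pos i)
    _ = _ := by simp [Finset.sum_sub_distrib]

theorem re_det_pos {P : Matrix n n ℂ} (hP : P.PosDef) : 0 < P.det.re :=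
  (Complex.pos_iff.1 hP.det_pos).1

/-- Equality holds when `Q * E = 1`, which is what makes the resulting bound on the rate tight at
the LMMSE receiver. -/
theorem log_re_det_add_log_re_det_le {Q E : Matrix n n ℂ} (hQ : Q.PosDef) (hE : E.PosDef) :
    Real.log Q.det.re + Real.log E.det.re ≤ (Q * E).trace.re - Fintype.card n := by
  obtain ⟨B, hBu, hB⟩ := exists_isUnit_eq_conjTranspose_mul_self hQ
  have hP : (B * E * Bᴴ).PosDef :=
    hE.mul_mul_conjTranspose_same (Matrix.vecMul_injective_of_isUnit hBu)
  have htr : (B * E * Bᴴ).trace = (Q * E).trace := by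
    rw [hB, Matrix.trace_mul_cycle]
  have hdet : (B * E * Bᴴ).det.re = Q.det.re * E.det.re := by
    have h1 : (B * E * Bᴴ).det = Q.det * E.det := by
      rw [hB]; simp only [Matrix.det_mul]; ring
    rw [h1, Complex.mul_re, ← (Complex.pos_iff.1 hQ.det_pos).2]
    ring
  have h := log_re_det_le hP
  rwa [htr, hdet, Real.log_mul (re_det_pos hQ).ne' (re_det_pos hE).ne'] at h

end Matrices

/-- A real quadratic polynomial that vanishes at `0` and has a minimum there has no linear term. -/
theorem linear_coeff_eq_zero {a b : ℝ} (h : ∀ t : ℝ, 0 ≤ t * a + t ^ 2 * b) : a = 0 := by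
  by_contra ha
  have hb : 0 < |b| + 1 := by positivity
  -- `|b| + 1` bounds `b` strictly and stays positive when `b = 0`.
  have h1 := h (-a / (|b| + 1))
  have h2 : -a / (|b| + 1) * a + (-a / (|b| + 1)) ^ 2 * b
      = a ^ 2 / (|b| + 1) ^ 2 * (b - (|b| + 1)) := by
    field_simp
    ring
  have h3 : 0 < a ^ 2 / (|b| + 1) ^ 2 := by positivity
  nlinarith [le_abs_self b]

variable {K Nt Nr Ns : ℕ}

/-! ### The LMMSE receiver -/

/-- Covariance of the received signal `y_k`, the desired stream included. -/
def rxCov (H : Fin K → Matrix (Fin Nt) (Fin Nr) ℂ) (σ : Fin K → ℝ)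
    (F : Fin K → Matrix (Fin Nt) (Fin Ns) ℂ) (k : Fin K) : Matrix (Fin Nr) (Fin Nr) ℂ :=
  (((σ k) ^ 2 : ℝ) : ℂ) • (1 : Matrix (Fin Nr) (Fin Nr) ℂ)
    + ∑ i, (H k)ᴴ * F i * (F i)ᴴ * H k

/-- The closed form `F_kᴴ H_k R_k⁻¹` of the LMMSE receiver. -/
def lmmse (H : Fin K → Matrix (Fin Nt) (Fin Nr) ℂ) (σ : Fin K → ℝ)
    (F : Fin K → Matrix (Fin Nt) (Fin Ns) ℂ) (k : Fin K) : Matrix (Fin Ns) (Fin Nr) ℂ :=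
  (F k)ᴴ * H k * (rxCov H σ F k)⁻¹

/-- The matrix whose log-determinant is the rate of user `k`; it turns out to be the inverse of
the error covariance of the LMMSE receiver. -/
def rateMatrix (H : Fin K → Matrix (Fin Nt) (Fin Nr) ℂ) (σ : Fin K → ℝ)
    (F : Fin K → Matrix (Fin Nt) (Fin Ns) ℂ) (k : Fin K) : Matrix (Fin Ns) (Fin Ns) ℂ :=
  1 + (F k)ᴴ * H k * (noiseCov H σ F k)⁻¹ * (H k)ᴴ * F k

section Receiver

variable (H : Fin K → Matrix (Fin Nt) (Fin Nr) ℂ) (σ : Fin K → ℝ)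
  (F : Fin K → Matrix (Fin Nt) (Fin Ns) ℂ) (k : Fin K)

theorem rxCov_eq : rxCov H σ F k = noiseCov H σ F k + (H k)ᴴ * F k * (F k)ᴴ * H k := by
  rw [rxCov, noiseCov, ← Finset.sum_erase_add _ _ (Finset.mem_univ k), add_assoc]

theorem posSemidef_signalCov (i : Fin K) : ((H k)ᴴ * F i * (F i)ᴴ * H k).PosSemidef := by
  have h := Matrix.posSemidef_self_mul_conjTranspose ((H k)ᴴ * F i)
  rwa [Matrix.conjTranspose_mul, Matrix.conjTranspose_conjTranspose, ← Matrix.mul_assoc] at h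

variable {σ} in
theorem noiseCov_posDef (hσ : 0 < σ k) : (noiseCov H σ F k).PosDef := by
  have h : (0 : ℂ) < (((σ k) ^ 2 : ℝ) : ℂ) := by
    exact_mod_cast pow_pos hσ 2
  exact (Matrix.PosDef.one.smul h).add_posSemidef
    (Matrix.posSemidef_sum _ fun i _ => posSemidef_signalCov H F k i)

variable {σ} in
theorem rxCov_posDef (hσ : 0 < σ k) : (rxCov H σ F k).PosDef := by
  rw [rxCov_eq]
  exact (noiseCov_posDef H F k hσ).add_posSemidef (posSemidef_signalCov H F k k)

variable {σ} in
theorem rateMatrix_posDef (hσ : 0 < σ k) : (rateMatrix H σ F k).PosDef := by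
  have h := (noiseCov_posDef H F k hσ).inv.posSemidef.conjTranspose_mul_mul_same ((H k)ᴴ * F k)
  rw [Matrix.conjTranspose_mul, Matrix.conjTranspose_conjTranspose, ← Matrix.mul_assoc] at h
  exact Matrix.PosDef.one.add_posSemidef h

theorem mseMatrix_eq (V : Matrix (Fin Ns) (Fin Nr) ℂ) :
    mseMatrix H σ F k V = 1 - V * (H k)ᴴ * F k - (V * (H k)ᴴ * F k)ᴴ + V * rxCov H σ F k * Vᴴ := by
  rw [mseMatrix, rxCov_eq]
  simp only [Matrix.conjTranspose_sub, Matrix.conjTranspose_one, Matrix.conjTranspose_mul,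
    Matrix.conjTranspose_conjTranspose, Matrix.mul_add, Matrix.add_mul, Matrix.mul_sub,
    Matrix.sub_mul, Matrix.mul_one, Matrix.one_mul, Matrix.mul_assoc]
  abel

variable {σ} in
theorem lmmse_mul_rxCov (hσ : 0 < σ k) : lmmse H σ F k * rxCov H σ F k = (F k)ᴴ * H k := by
  rw [lmmse, Matrix.mul_assoc,
    Matrix.nonsing_inv_mul _ ((Matrix.isUnit_iff_isUnit_det _).1 (rxCov_posDef H F k hσ).isUnit),
    Matrix.mul_one]

variable {σ} in
theorem rxCov_mul_lmmse (hσ : 0 < σ k) : rxCov H σ F k * (lmmse H σ F k)ᴴ = (H k)ᴴ * F k := by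
  have h := congrArg Matrix.conjTranspose (lmmse_mul_rxCov H F k hσ)
  simpa [Matrix.conjTranspose_mul, (rxCov_posDef H F k hσ).isHermitian.eq] using h

/-- Completion of the square: the LMMSE receiver minimizes the error covariance in the Loewner
order. -/
theorem mseMatrix_eq_add {σ : Fin K → ℝ} (hσ : 0 < σ k) (V : Matrix (Fin Ns) (Fin Nr) ℂ) :
    mseMatrix H σ F k V = mseMatrix H σ F k (lmmse H σ F k)
      + (V - lmmse H σ F k) * rxCov H σ F k * (V - lmmse H σ F k)ᴴ := by
  have h1 := lmmse_mul_rxCov H F k hσ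
  have h2 := rxCov_mul_lmmse H F k hσ
  have h3 : (F k)ᴴ * H k * (lmmse H σ F k)ᴴ = lmmse H σ F k * (H k)ᴴ * F k := by
    rw [← h1, Matrix.mul_assoc, h2, ← Matrix.mul_assoc]
  rw [mseMatrix_eq, mseMatrix_eq]
  simp only [Matrix.conjTranspose_sub, Matrix.mul_sub, Matrix.sub_mul, h1,
    Matrix.mul_assoc, h2, Matrix.conjTranspose_mul, Matrix.conjTranspose_conjTranspose]
  simp only [← Matrix.mul_assoc, h3]
  abel

theorem rateMatrix_mul_mseMatrix {σ : Fin K → ℝ} (hσ : 0 < σ k) :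
    rateMatrix H σ F k * mseMatrix H σ F k (lmmse H σ F k) = 1 := by
  have hE : mseMatrix H σ F k (lmmse H σ F k) = 1 - lmmse H σ F k * ((H k)ᴴ * F k) := by
    rw [mseMatrix_eq, lmmse_mul_rxCov H F k hσ]
    simp only [Matrix.conjTranspose_mul, Matrix.conjTranspose_conjTranspose, Matrix.mul_assoc]
    abel
  rw [mul_eq_one_comm, hE, rateMatrix]
  have hC : noiseCov H σ F k * (noiseCov H σ F k)⁻¹ = 1 :=
    Matrix.mul_nonsing_inv _
      ((Matrix.isUnit_iff_isUnit_det _).1 (noiseCov_posDef H F k hσ).isUnit)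
  have hR := lmmse_mul_rxCov H F k hσ
  rw [rxCov_eq, Matrix.mul_assoc _ (F k)ᴴ] at hR
  rw [Matrix.mul_assoc _ _ (F k)]
  generalize lmmse H σ F k = W at *
  generalize (F k)ᴴ * H k = B at *
  generalize (H k)ᴴ * F k = A at *
  generalize (noiseCov H σ F k)⁻¹ = C' at *
  -- Substituting `B = W R = W (C + A B)` and cancelling `C C⁻¹`.
  have hW : B * C' = W + W * A * B * C' := by
    conv_lhs => rw [← hR]
    rw [Matrix.mul_add, Matrix.add_mul, Matrix.mul_assoc W, hC, Matrix.mul_one]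
    simp only [Matrix.mul_assoc]
  have hWA : B * C' * A = W * A + W * A * (B * C' * A) := by
    conv_lhs => rw [hW]
    rw [Matrix.add_mul]
    simp only [Matrix.mul_assoc]
  rw [Matrix.sub_mul, Matrix.one_mul, Matrix.mul_add, Matrix.mul_one, ← hWA,
    add_sub_cancel_right]

theorem mseMatrix_lmmse_posDef {σ : Fin K → ℝ} (hσ : 0 < σ k) :
    (mseMatrix H σ F k (lmmse H σ F k)).PosDef := by
  rw [← Matrix.inv_eq_right_inv (rateMatrix_mul_mseMatrix H F k hσ)]
  exact (rateMatrix_posDef H F k hσ).inv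

theorem re_trace_mul_mseMatrix_lmmse_le {σ : Fin K → ℝ} (hσ : 0 < σ k)
    {Q : Matrix (Fin Ns) (Fin Ns) ℂ} (hQ : Q.PosSemidef) (V : Matrix (Fin Ns) (Fin Nr) ℂ) :
    (Q * mseMatrix H σ F k (lmmse H σ F k)).trace.re ≤ (Q * mseMatrix H σ F k V).trace.re := by
  rw [mseMatrix_eq_add H F k hσ V, Matrix.mul_add, Matrix.trace_add, Complex.add_re]
  have := re_trace_mul_nonneg hQ
    ((rxCov_posDef H F k hσ).posSemidef.mul_mul_conjTranspose_same (V - lmmse H σ F k))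
  linarith

theorem isLMMSEReceiver_lmmse {σ : Fin K → ℝ} (hσ : 0 < σ k) :
    IsLMMSEReceiver H σ F k (lmmse H σ F k) := fun V => by
  simpa using re_trace_mul_mseMatrix_lmmse_le H F k hσ Matrix.PosSemidef.one V

theorem rate_mul_log_two : rate H σ F k * Real.log 2 = Real.log (rateMatrix H σ F k).det.re := by
  rw [rate, rateMatrix, Real.logb, div_mul_cancel₀ _ (Real.log_pos one_lt_two).ne']

/-- The variational lower bound on the rate: any receiver `V` and any weight `Q` bound the rate
from below by minus a weighted mean square error, up to constants. -/
theorem log_re_det_sub_le {σ : Fin K → ℝ} (hσ : 0 < σ k) {Q : Matrix (Fin Ns) (Fin Ns) ℂ}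
    (hQ : Q.PosDef) (V : Matrix (Fin Ns) (Fin Nr) ℂ) :
    Real.log Q.det.re + Ns - (Q * mseMatrix H σ F k V).trace.re ≤ rate H σ F k * Real.log 2 := by
  have hE := mseMatrix_lmmse_posDef H F k hσ
  have h1 := log_re_det_add_log_re_det_le hQ hE
  have h2 := re_trace_mul_mseMatrix_lmmse_le H F k hσ hQ.posSemidef V
  have h3 : Real.log (rateMatrix H σ F k).det.re
      + Real.log (mseMatrix H σ F k (lmmse H σ F k)).det.re = 0 := by
    have h := congrArg (fun M => (Matrix.det M).re) (rateMatrix_mul_mseMatrix H F k hσ)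
    simp only [Matrix.det_mul, Matrix.det_one, Complex.one_re, Complex.mul_re,
      ← (Complex.pos_iff.1 hE.det_pos).2, mul_zero, sub_zero] at h
    rw [← Real.log_mul (re_det_pos (rateMatrix_posDef H F k hσ)).ne' (re_det_pos hE).ne', h,
      Real.log_one]
  rw [rate_mul_log_two]
  rw [Fintype.card_fin] at h1
  linarith

end Receiver

/-! ### The weighted mean square error as a quadratic function of the precoder -/

/-- The matrix `∑ m, H_m W_mᴴ Q_m W_m H_mᴴ` of the quadratic part of the weighted mean square
error. -/
def gram (H : Fin K → Matrix (Fin Nt) (Fin Nr) ℂ) (W : Fin K → Matrix (Fin Ns) (Fin Nr) ℂ)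
    (Q : Fin K → Matrix (Fin Ns) (Fin Ns) ℂ) : Matrix (Fin Nt) (Fin Nt) ℂ :=
  ∑ m, H m * (W m)ᴴ * Q m * W m * (H m)ᴴ

theorem gram_posSemidef (H : Fin K → Matrix (Fin Nt) (Fin Nr) ℂ)
    (W : Fin K → Matrix (Fin Ns) (Fin Nr) ℂ) {Q : Fin K → Matrix (Fin Ns) (Fin Ns) ℂ}
    (hQ : ∀ k, (Q k).PosSemidef) : (gram H W Q).PosSemidef := by
  refine Matrix.posSemidef_sum _ fun m _ => ?_
  have h := (hQ m).conjTranspose_mul_mul_same (W m * (H m)ᴴ)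
  rwa [Matrix.conjTranspose_mul, Matrix.conjTranspose_conjTranspose, ← Matrix.mul_assoc] at h

theorem re_trace_mul_mseMatrix_smul (H : Fin K → Matrix (Fin Nt) (Fin Nr) ℂ) (σ : Fin K → ℝ)
    (F : Fin K → Matrix (Fin Nt) (Fin Ns) ℂ) (k : Fin K) (W : Matrix (Fin Ns) (Fin Nr) ℂ)
    {Q : Matrix (Fin Ns) (Fin Ns) ℂ} (hQ : Q.IsHermitian) (c : ℝ) :
    (Q * mseMatrix H σ F k ((c : ℂ) • W)).trace.re
      = Q.trace.re - 2 * (c * ((F k)ᴴ * (H k * Wᴴ * Q)).trace.re)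
        + c ^ 2 * (σ k ^ 2 * (Wᴴ * Q * W).trace.re
          + ∑ i, ((F i)ᴴ * (H k * Wᴴ * Q * W * (H k)ᴴ) * F i).trace.re) := by
  have h1 : (Q * (W * (H k)ᴴ * F k)ᴴ).trace = ((F k)ᴴ * (H k * Wᴴ * Q)).trace := by
    rw [Matrix.trace_mul_comm]
    simp only [Matrix.conjTranspose_mul, Matrix.conjTranspose_conjTranspose, Matrix.mul_assoc]
  have h2 : (Q * (W * (H k)ᴴ * F k)).trace.re = ((F k)ᴴ * (H k * Wᴴ * Q)).trace.re := by
    rw [← h1, ← re_trace_conjTranspose, Matrix.conjTranspose_mul, hQ.eq, Matrix.trace_mul_comm]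
  have h3 : (Q * (W * Wᴴ)).trace = (Wᴴ * Q * W).trace := by
    rw [← Matrix.mul_assoc, Matrix.trace_mul_comm, Matrix.mul_assoc]
  have h4 (i : Fin K) : (Q * (W * ((H k)ᴴ * F i * (F i)ᴴ * H k) * Wᴴ)).trace
      = ((F i)ᴴ * (H k * Wᴴ * Q * W * (H k)ᴴ) * F i).trace := by
    have h := Matrix.trace_mul_comm (Q * W * (H k)ᴴ * F i) ((F i)ᴴ * H k * Wᴴ)
    simpa only [Matrix.mul_assoc] using h
  have hcc : (starRingEnd ℂ) (c : ℂ) = c := Complex.conj_ofReal c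
  have h5 : Q * mseMatrix H σ F k ((c : ℂ) • W) = Q - (c : ℂ) • (Q * (W * (H k)ᴴ * F k))
      - (c : ℂ) • (Q * (W * (H k)ᴴ * F k)ᴴ)
      + ((c ^ 2 : ℝ) : ℂ) • ((((σ k) ^ 2 : ℝ) : ℂ) • (Q * (W * Wᴴ))
        + ∑ i, Q * (W * ((H k)ᴴ * F i * (F i)ᴴ * H k) * Wᴴ)) := by
    rw [mseMatrix_eq, rxCov]
    simp only [Matrix.conjTranspose_smul, Matrix.smul_mul, Matrix.mul_smul, Matrix.mul_add,
      Matrix.add_mul, Matrix.mul_sub, Matrix.mul_one, Matrix.mul_sum, Matrix.sum_mul, smul_smul,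
      RCLike.star_def, hcc, smul_add, Finset.smul_sum]
    push_cast
    simp only [pow_two, mul_comm, mul_left_comm]
  rw [h5]
  simp only [Matrix.trace_add, Matrix.trace_sub, Matrix.trace_smul, Matrix.trace_sum, h1, h3, h4,
    Complex.add_re, Complex.sub_re, Complex.re_sum, smul_eq_mul, Complex.re_ofReal_mul, h2]
  ring

theorem sum_re_trace_mul_mseMatrix_smul (H : Fin K → Matrix (Fin Nt) (Fin Nr) ℂ) (σ : Fin K → ℝ)
    (F : Fin K → Matrix (Fin Nt) (Fin Ns) ℂ) (W : Fin K → Matrix (Fin Ns) (Fin Nr) ℂ)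
    {Q : Fin K → Matrix (Fin Ns) (Fin Ns) ℂ} (hQ : ∀ k, (Q k).IsHermitian) (c : ℝ)
    {Es : ℝ} (hEs : Es ≠ 0) :
    ∑ k, (Q k * mseMatrix H σ F k ((c : ℂ) • W k)).trace.re
      = ∑ k, (Q k).trace.re - 2 * (c * ∑ k, ((F k)ᴴ * (H k * (W k)ᴴ * Q k)).trace.re)
        + c ^ 2 * (Es * ∑ k, regCoeff σ Es W Q k
          + ∑ i, ((F i)ᴴ * gram H W Q * F i).trace.re) := by
  have h1 : Es * ∑ k, regCoeff σ Es W Q k = ∑ k, σ k ^ 2 * ((W k)ᴴ * Q k * W k).trace.re := by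
    rw [Finset.mul_sum]
    refine Finset.sum_congr rfl fun k _ => ?_
    rw [regCoeff]
    field_simp
  have h2 : ∑ i, ((F i)ᴴ * gram H W Q * F i).trace.re
      = ∑ k, ∑ i, ((F i)ᴴ * (H k * (W k)ᴴ * Q k * W k * (H k)ᴴ) * F i).trace.re := by
    rw [Finset.sum_comm]
    refine Finset.sum_congr rfl fun i _ => ?_
    rw [gram, Matrix.mul_sum, Matrix.sum_mul, Matrix.trace_sum, Complex.re_sum]
  simp only [re_trace_mul_mseMatrix_smul _ _ _ _ _ (hQ _), h1, h2, Finset.mul_sum,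
    Finset.sum_add_distrib, Finset.sum_sub_distrib, mul_add]

theorem totalPower_smul (c : ℝ) (F : Fin K → Matrix (Fin Nt) (Fin Ns) ℂ) :
    totalPower (fun k => (c : ℂ) • F k) = c ^ 2 * totalPower F := by
  simp only [totalPower, Matrix.conjTranspose_smul, Matrix.smul_mul, Matrix.mul_smul, smul_smul,
    Matrix.trace_smul, RCLike.star_def, Complex.conj_ofReal, Finset.mul_sum, smul_eq_mul,
    ← Complex.ofReal_mul, Complex.re_ofReal_mul, pow_two]

theorem totalPower_eq (F : Fin K → Matrix (Fin Nt) (Fin Ns) ℂ) :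
    totalPower F = ∑ k, ((F k)ᴴ * F k).trace.re := by
  simp only [totalPower, Matrix.trace_mul_comm (F _)]

theorem totalPower_nonneg (F : Fin K → Matrix (Fin Nt) (Fin Ns) ℂ) : 0 ≤ totalPower F := by
  rw [totalPower_eq]
  exact Finset.sum_nonneg fun k _ => re_trace_conjTranspose_mul_self_nonneg _

theorem eq_zero_of_totalPower_eq_zero {F : Fin K → Matrix (Fin Nt) (Fin Ns) ℂ}
    (h : totalPower F = 0) (k : Fin K) : F k = 0 := by
  rw [totalPower_eq,
    Finset.sum_eq_zero_iff_of_nonneg fun k _ => re_trace_conjTranspose_mul_self_nonneg _] at h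
  exact eq_zero_of_re_trace_conjTranspose_mul_self (h k (Finset.mem_univ k))

/-- Every precoder is a real multiple `c` of one of admissible power, where `c ^ 2` is the ratio of
its power to the budget. -/
theorem exists_eq_smul_of_totalPower {Es : ℝ} (hEs : 0 < Es)
    (F : Fin K → Matrix (Fin Nt) (Fin Ns) ℂ) :
    ∃ (c : ℝ) (F' : Fin K → Matrix (Fin Nt) (Fin Ns) ℂ),
      c ^ 2 * Es = totalPower F ∧ totalPower F' ≤ Es ∧ ∀ k, F k = (c : ℂ) • F' k := by
  rcases (totalPower_nonneg F).eq_or_lt with h | h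
  · refine ⟨0, fun _ => 0, by simp [← h], by simp [totalPower, hEs.le], fun k => ?_⟩
    simp [eq_zero_of_totalPower_eq_zero h.symm k]
  · have hc : 0 < totalPower F / Es := div_pos h hEs
    have hs : Real.sqrt (totalPower F / Es) ≠ 0 := (Real.sqrt_pos.2 hc).ne'
    refine ⟨Real.sqrt (totalPower F / Es),
      fun k => (((Real.sqrt (totalPower F / Es))⁻¹ : ℝ) : ℂ) • F k, ?_, ?_, fun k => ?_⟩
    · rw [Real.sq_sqrt hc.le, div_mul_cancel₀ _ hEs.ne']
    · rw [totalPower_smul, inv_pow, Real.sq_sqrt hc.le]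
      exact (by field_simp : (totalPower F / Es)⁻¹ * totalPower F = Es).le
    · rw [smul_smul, ← Complex.ofReal_mul, mul_inv_cancel₀ hs, Complex.ofReal_one, one_smul]

/-! ### Consequences of optimality -/

section Optimal

variable {H : Fin K → Matrix (Fin Nt) (Fin Nr) ℂ} {σ : Fin K → ℝ} {Es : ℝ}
  {F : Fin K → Matrix (Fin Nt) (Fin Ns) ℂ}

/-- With the weights frozen at the rate matrices of an optimal precoder, no admissible precoder
and no receivers have a smaller weighted mean square error than the optimal ones. -/
theorem IsOptimalPrecoder.le_sum_re_trace (hF : IsOptimalPrecoder H σ Es F) (hσ : ∀ k, 0 < σ k)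
    {F' : Fin K → Matrix (Fin Nt) (Fin Ns) ℂ} (hF' : totalPower F' ≤ Es)
    (V : Fin K → Matrix (Fin Ns) (Fin Nr) ℂ) :
    (K * Ns : ℝ) ≤ ∑ k, (rateMatrix H σ F k * mseMatrix H σ F' k (V k)).trace.re := by
  have h1 := mul_le_mul_of_nonneg_right (hF.2 F' hF') (Real.log_pos one_lt_two).le
  have h2 := Finset.sum_le_sum fun k (_ : k ∈ Finset.univ) =>
    log_re_det_sub_le H F' k (hσ k) (rateMatrix_posDef H F k (hσ k)) (V k)
  simp only [sumRate, Finset.sum_mul] at h1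
  simp only [← rate_mul_log_two, Finset.sum_sub_distrib, Finset.sum_add_distrib,
    Finset.sum_const, Finset.card_univ, Fintype.card_fin, nsmul_eq_mul] at h2
  linarith

theorem sum_re_trace_rateMatrix_mul_mseMatrix (hσ : ∀ k, 0 < σ k) :
    ∑ k, (rateMatrix H σ F k * mseMatrix H σ F k (lmmse H σ F k)).trace.re = K * Ns := by
  simp [rateMatrix_mul_mseMatrix H F _ (hσ _)]

/-- The power constraint absorbed into the objective: scaling a precoder to the power budget while
scaling the receivers inversely turns the noise term into a multiple of the transmit power. -/
theorem IsOptimalPrecoder.le_quadratic (hF : IsOptimalPrecoder H σ Es F) (hσ : ∀ k, 0 < σ k)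
    (hEs : 0 < Es) (W : Fin K → Matrix (Fin Ns) (Fin Nr) ℂ)
    (F' : Fin K → Matrix (Fin Nt) (Fin Ns) ℂ) :
    (K * Ns : ℝ) ≤ ∑ k, (rateMatrix H σ F k).trace.re
      - 2 * ∑ k, ((F' k)ᴴ * (H k * (W k)ᴴ * rateMatrix H σ F k)).trace.re
      + totalPower F' * ∑ k, regCoeff σ Es W (rateMatrix H σ F) k
      + ∑ k, ((F' k)ᴴ * gram H W (rateMatrix H σ F) * F' k).trace.re := by
  obtain ⟨c, F'', hc, hF'', h⟩ := exists_eq_smul_of_totalPower hEs F'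
  have h1 := hF.le_sum_re_trace hσ hF'' fun k => (c : ℂ) • W k
  rw [sum_re_trace_mul_mseMatrix_smul _ _ _ _
    (fun k => (rateMatrix_posDef H F k (hσ k)).isHermitian) c hEs.ne'] at h1
  refine h1.trans_eq ?_
  simp only [h, Matrix.conjTranspose_smul, RCLike.star_def, Complex.conj_ofReal, Matrix.smul_mul,
    Matrix.mul_smul, Matrix.trace_smul, smul_eq_mul, Complex.re_ofReal_mul, ← Finset.mul_sum]
  rw [← hc]
  ring

/-- The minimal value is attained at `F` with unscaled receivers. The regularization term carries
the budget `Es` and not `totalPower F`, and comparison with `IsOptimalPrecoder.le_quadratic` at `F`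
therefore forces full power. -/
theorem quadratic_eq (hσ : ∀ k, 0 < σ k) (hEs : 0 < Es) :
    (K * Ns : ℝ) = ∑ k, (rateMatrix H σ F k).trace.re
      - 2 * ∑ k, ((F k)ᴴ * (H k * (lmmse H σ F k)ᴴ * rateMatrix H σ F k)).trace.re
      + Es * ∑ k, regCoeff σ Es (lmmse H σ F) (rateMatrix H σ F) k
      + ∑ k, ((F k)ᴴ * gram H (lmmse H σ F) (rateMatrix H σ F) * F k).trace.re := by
  have h := sum_re_trace_mul_mseMatrix_smul H σ F (lmmse H σ F)
    (fun k => (rateMatrix_posDef H F k (hσ k)).isHermitian) 1 hEs.ne'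
  simp only [Complex.ofReal_one, one_smul, sum_re_trace_rateMatrix_mul_mseMatrix hσ] at h
  rw [h]
  ring

theorem regCoeff_nonneg (hEs : 0 < Es) {W : Fin K → Matrix (Fin Ns) (Fin Nr) ℂ}
    {Q : Fin K → Matrix (Fin Ns) (Fin Ns) ℂ} {k : Fin K} (hQ : (Q k).PosSemidef) :
    0 ≤ regCoeff σ Es W Q k :=
  mul_nonneg (by positivity)
    (Complex.nonneg_iff.1 (hQ.conjTranspose_mul_mul_same (W k)).trace_nonneg).1

theorem eq_zero_of_regCoeff_eq_zero (hEs : 0 < Es) {W : Fin K → Matrix (Fin Ns) (Fin Nr) ℂ}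
    {Q : Fin K → Matrix (Fin Ns) (Fin Ns) ℂ} {k : Fin K} (hσ : 0 < σ k) (hQ : (Q k).PosDef)
    (h : regCoeff σ Es W Q k = 0) : W k = 0 := by
  obtain ⟨B, hBu, hB⟩ := exists_isUnit_eq_conjTranspose_mul_self hQ
  have h1 : (W k)ᴴ * Q k * W k = (B * W k)ᴴ * (B * W k) := by
    rw [hB, Matrix.conjTranspose_mul]
    simp only [Matrix.mul_assoc]
  have h2 : B * W k = 0 := by
    refine eq_zero_of_re_trace_conjTranspose_mul_self ?_
    rw [← h1]
    exact (mul_eq_zero.1 h).resolve_left (by positivity)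
  have h3 := Matrix.nonsing_inv_mul B ((Matrix.isUnit_iff_isUnit_det _).1 hBu)
  rw [← Matrix.one_mul (W k), ← h3, Matrix.mul_assoc, h2, Matrix.mul_zero]

/-- Otherwise all weights are the identity and, since some channel is nonzero, a weak receiver
matched to a suitable precoder would have a smaller mean square error. -/
theorem IsOptimalPrecoder.exists_lmmse_ne_zero (hF : IsOptimalPrecoder H σ Es F)
    (hσ : ∀ k, 0 < σ k) (hEs : 0 < Es) (hNs : 0 < Ns) (hH : ∃ k, H k ≠ 0) :
    ∃ k, lmmse H σ F k ≠ 0 := by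
  by_contra! hW
  have hQ (k : Fin K) : rateMatrix H σ F k = 1 := by
    have h := rateMatrix_mul_mseMatrix H F k (hσ k)
    rwa [hW, mseMatrix_eq, Matrix.zero_mul, Matrix.zero_mul, Matrix.zero_mul, Matrix.zero_mul,
      Matrix.conjTranspose_zero, sub_zero, sub_zero, add_zero, Matrix.mul_one] at h
  obtain ⟨k, hk⟩ := hH
  obtain ⟨i, j, hij⟩ : ∃ i j, H k i j ≠ 0 := by
    by_contra! h
    exact hk (Matrix.ext h)
  -- `X` has power exactly `Es` and meets the nonzero entry `(i, j)` of the channel.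
  set X : Matrix (Fin Nt) (Fin Ns) ℂ := Matrix.single i ⟨0, hNs⟩ ((Real.sqrt Es : ℝ) : ℂ) with hX
  have hXp : (X * Xᴴ).trace.re = Es := by
    rw [hX, Matrix.conjTranspose_single, Matrix.single_mul_single_same, Matrix.trace_single_eq_same,
      RCLike.star_def, Complex.conj_ofReal, ← Complex.ofReal_mul, Complex.ofReal_re,
      Real.mul_self_sqrt hEs.le]
  have hHX : (H k)ᴴ * X ≠ 0 := by
    intro h
    have h1 := congrFun (congrFun h j) ⟨0, hNs⟩
    rw [hX, Matrix.mul_single_apply_same, Matrix.conjTranspose_apply, Matrix.zero_apply,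
      mul_eq_zero] at h1
    have hs : ((Real.sqrt Es : ℝ) : ℂ) ≠ 0 := by
      exact_mod_cast (Real.sqrt_pos.2 hEs).ne'
    exact hij (star_eq_zero.1 (h1.resolve_right hs))
  set F' : Fin K → Matrix (Fin Nt) (Fin Ns) ℂ := Pi.single k X with hF'
  set V : Fin K → Matrix (Fin Ns) (Fin Nr) ℂ := Pi.single k ((H k)ᴴ * X)ᴴ with hV
  have hp : totalPower F' ≤ Es := by
    rw [totalPower, Finset.sum_eq_single k (fun m _ hm => by simp [hF', hm]) (by simp)]
    simp [hF', hXp]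
  have key : (((H k)ᴴ * X)ᴴ * ((H k)ᴴ * X)).trace.re = 0 := by
    have h := linear_coeff_eq_zero
      (a := -2 * ∑ m, ((F' m)ᴴ * (H m * (V m)ᴴ * (1 : Matrix (Fin Ns) (Fin Ns) ℂ))).trace.re)
      (b := Es * ∑ m, regCoeff σ Es V (fun _ => 1) m
          + ∑ m, ((F' m)ᴴ * gram H V (fun _ => 1) * F' m).trace.re) fun t => by
        have h1 := hF.le_sum_re_trace hσ hp fun m => (t : ℂ) • V m
        simp only [hQ] at h1
        rw [sum_re_trace_mul_mseMatrix_smul (Q := fun _ => 1) _ _ _ _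
          (fun _ => Matrix.isHermitian_one) t hEs.ne'] at h1
        simp only [Matrix.trace_one, Fintype.card_fin, Complex.natCast_re, Finset.sum_const,
          Finset.card_univ, nsmul_eq_mul] at h1
        linarith
    rw [Finset.sum_eq_single k (fun m _ hm => by simp [hF', hm]) (by simp)] at h
    simp only [hF', hV, Pi.single_eq_same, Matrix.mul_one, Matrix.conjTranspose_conjTranspose] at h
    rw [Matrix.conjTranspose_mul, Matrix.conjTranspose_conjTranspose, Matrix.mul_assoc]
    linarith
  exact hHX (eq_zero_of_re_trace_conjTranspose_mul_self key)

theorem IsOptimalPrecoder.sum_regCoeff_pos (hF : IsOptimalPrecoder H σ Es F)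
    (hσ : ∀ k, 0 < σ k) (hEs : 0 < Es) (hNs : 0 < Ns) (hH : ∃ k, H k ≠ 0) :
    0 < ∑ k, regCoeff σ Es (lmmse H σ F) (rateMatrix H σ F) k := by
  have h0 (k : Fin K) : 0 ≤ regCoeff σ Es (lmmse H σ F) (rateMatrix H σ F) k :=
    regCoeff_nonneg hEs (rateMatrix_posDef H F k (hσ k)).posSemidef
  obtain ⟨k, hk⟩ := hF.exists_lmmse_ne_zero hσ hEs hNs hH
  refine Finset.sum_pos' (fun k _ => h0 k) ⟨k, Finset.mem_univ k, (h0 k).lt_of_ne' fun h => ?_⟩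
  exact hk (eq_zero_of_regCoeff_eq_zero hEs (hσ k) (rateMatrix_posDef H F k (hσ k)) h)

theorem IsOptimalPrecoder.totalPower_eq (hF : IsOptimalPrecoder H σ Es F)
    (hσ : ∀ k, 0 < σ k) (hEs : 0 < Es) (hNs : 0 < Ns) (hH : ∃ k, H k ≠ 0) :
    totalPower F = Es := by
  refine hF.1.antisymm ?_
  have h1 := hF.le_quadratic hσ hEs (lmmse H σ F) F
  have h2 := quadratic_eq (H := H) (F := F) hσ hEs
  exact le_of_mul_le_mul_right (by linarith) (hF.sum_regCoeff_pos hσ hEs hNs hH)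

/-- Stationarity of the quadratic function at `F`, in the direction of its own gradient. -/
theorem IsOptimalPrecoder.normal_equation (hF : IsOptimalPrecoder H σ Es F)
    (hσ : ∀ k, 0 < σ k) (hEs : 0 < Es) (hP : totalPower F = Es) (k : Fin K) :
    (((∑ m, regCoeff σ Es (lmmse H σ F) (rateMatrix H σ F) m : ℝ) : ℂ)
        • (1 : Matrix (Fin Nt) (Fin Nt) ℂ) + gram H (lmmse H σ F) (rateMatrix H σ F)) * F k
      = H k * (lmmse H σ F k)ᴴ * rateMatrix H σ F k := by
  have hq := quadratic_eq (H := H) (F := F) hσ hEs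
  have hle := hF.le_quadratic hσ hEs (lmmse H σ F)
  have hM := (gram_posSemidef H (lmmse H σ F)
    fun k => (rateMatrix_posDef H F k (hσ k)).posSemidef).isHermitian
  set β := ∑ m, regCoeff σ Es (lmmse H σ F) (rateMatrix H σ F) m
  set M := gram H (lmmse H σ F) (rateMatrix H σ F)
  set G := fun k => H k * (lmmse H σ F k)ᴴ * rateMatrix H σ F k with hG
  set T : Matrix (Fin Nt) (Fin Nt) ℂ := (β : ℂ) • 1 + M with hT
  have hTh : Tᴴ = T := by
    rw [hT, Matrix.conjTranspose_add, hM.eq, Matrix.conjTranspose_smul, Matrix.conjTranspose_one,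
      RCLike.star_def, Complex.conj_ofReal]
  set D := fun k => T * F k - G k with hD
  have hquad (X : Fin K → Matrix (Fin Nt) (Fin Ns) ℂ) :
      totalPower X * β + ∑ k, ((X k)ᴴ * M * X k).trace.re = ∑ k, ((X k)ᴴ * T * X k).trace.re := by
    rw [MUMIMO.totalPower_eq, Finset.sum_mul, ← Finset.sum_add_distrib]
    refine Finset.sum_congr rfl fun k _ => ?_
    rw [hT, Matrix.mul_add, Matrix.add_mul, Matrix.mul_smul, Matrix.mul_one, Matrix.smul_mul,
      Matrix.trace_add, Matrix.trace_smul, smul_eq_mul, Complex.add_re, Complex.re_ofReal_mul]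
    ring
  have hexp (t : ℝ) (k : Fin K) :
      ((F k - (t : ℂ) • D k)ᴴ * T * (F k - (t : ℂ) • D k)).trace.re
        - 2 * ((F k - (t : ℂ) • D k)ᴴ * G k).trace.re
      = (((F k)ᴴ * T * F k).trace.re - 2 * ((F k)ᴴ * G k).trace.re)
        + (t * (-2 * ((D k)ᴴ * D k).trace.re) + t ^ 2 * ((D k)ᴴ * T * D k).trace.re) := by
    have h1 : ((F k)ᴴ * T * D k).trace.re = ((D k)ᴴ * T * F k).trace.re := by
      rw [← re_trace_conjTranspose]
      simp only [Matrix.conjTranspose_mul, Matrix.conjTranspose_conjTranspose, hTh,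
        Matrix.mul_assoc]
    have h2 : ((D k)ᴴ * D k).trace.re
        = ((D k)ᴴ * T * F k).trace.re - ((D k)ᴴ * G k).trace.re := by
      rw [← Complex.sub_re, ← Matrix.trace_sub, Matrix.mul_assoc, ← Matrix.mul_sub]
    rw [h2]
    simp only [Matrix.conjTranspose_sub, Matrix.conjTranspose_smul, RCLike.star_def,
      Complex.conj_ofReal, Matrix.mul_sub, Matrix.sub_mul, Matrix.smul_mul, Matrix.mul_smul,
      Matrix.trace_sub, Matrix.trace_smul, smul_eq_mul, Complex.sub_re, Complex.re_ofReal_mul, h1]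
    ring
  have hzero := linear_coeff_eq_zero (a := ∑ k, -2 * ((D k)ᴴ * D k).trace.re)
    (b := ∑ k, ((D k)ᴴ * T * D k).trace.re) fun t => by
      have h1 := hle fun k => F k - (t : ℂ) • D k
      have h2 := hquad fun k => F k - (t : ℂ) • D k
      have h3 := hquad F
      rw [hP] at h3
      have h4 := Finset.sum_congr rfl fun k (_ : k ∈ Finset.univ) => hexp t k
      simp only [Finset.sum_add_distrib, Finset.sum_sub_distrib, ← Finset.mul_sum] at h4 ⊢
      linarith
  -- The sum of squared norms of the blocks of the gradient vanishes, so each block does.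
  rw [← Finset.mul_sum, mul_eq_zero, or_iff_right (by norm_num),
    Finset.sum_eq_zero_iff_of_nonneg fun k _ => re_trace_conjTranspose_mul_self_nonneg _] at hzero
  exact sub_eq_zero.1 (eq_zero_of_re_trace_conjTranspose_mul_self (hzero k (Finset.mem_univ k)))

end Optimal

end MUMIMO

end

open MUMIMO
theorem proposition2 {K Nt Nr Ns : ℕ} (hNs : 0 < Ns)
    (H : Fin K → Matrix (Fin Nt) (Fin Nr) ℂ) (hH : ∃ k, H k ≠ 0)
    (σ : Fin K → ℝ) (hσ : ∀ k, 0 < σ k) (Es : ℝ) (hEs : 0 < Es)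
    (F : Fin K → Matrix (Fin Nt) (Fin Ns) ℂ) (hF : IsOptimalPrecoder H σ Es F) :
    ∃ (W : Fin K → Matrix (Fin Ns) (Fin Nr) ℂ) (Q : Fin K → Matrix (Fin Ns) (Fin Ns) ℂ)
      (β γ : ℝ),
      (∀ k, IsLMMSEReceiver H σ F k (W k)) ∧
      (∀ k, (Q k).PosDef ∧ Q k * mseMatrix H σ F k (W k) = 1) ∧
      β = ∑ m, regCoeff σ Es W Q m ∧ 0 < β ∧
      0 < γ ∧ totalPower F = Es ∧
      (∀ k, F k = (γ : ℂ) •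
        ((∑ m, (((regCoeff σ Es W Q m : ℝ) : ℂ) • (1 : Matrix (Fin Nt) (Fin Nt) ℂ)
            + H m * (W m)ᴴ * Q m * W m * (H m)ᴴ))⁻¹ * H k * (W k)ᴴ * Q k)) ∧
      ((β : ℂ) • (1 : Matrix (Fin Nt) (Fin Nt) ℂ)
          + ∑ m, H m * (W m)ᴴ * Q m * W m * (H m)ᴴ).PosDef ∧
      (∀ k, F k = (γ : ℂ) •
        (((β : ℂ) • (1 : Matrix (Fin Nt) (Fin Nt) ℂ)
            + ∑ m, H m * (W m)ᴴ * Q m * W m * (H m)ᴴ)⁻¹ * H k * (W k)ᴴ * Q k)) := by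
  have hβ := hF.sum_regCoeff_pos hσ hEs hNs hH
  have hP := hF.totalPower_eq hσ hEs hNs hH
  have hN := hF.normal_equation hσ hEs hP
  have hpd : ((((∑ m, regCoeff σ Es (lmmse H σ F) (rateMatrix H σ F) m : ℝ) : ℂ)
      • (1 : Matrix (Fin Nt) (Fin Nt) ℂ)
        + gram H (lmmse H σ F) (rateMatrix H σ F))).PosDef := by
    refine (Matrix.PosDef.one.smul ?_).add_posSemidef (gram_posSemidef H _
      fun k => (rateMatrix_posDef H F k (hσ k)).posSemidef)
    exact_mod_cast hβ
  have hsol (k : Fin K) : F k = ((1 : ℝ) : ℂ) •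
      ((((∑ m, regCoeff σ Es (lmmse H σ F) (rateMatrix H σ F) m : ℝ) : ℂ)
        • (1 : Matrix (Fin Nt) (Fin Nt) ℂ) + gram H (lmmse H σ F) (rateMatrix H σ F))⁻¹
          * H k * (lmmse H σ F k)ᴴ * rateMatrix H σ F k) := by
    rw [Complex.ofReal_one, one_smul, Matrix.mul_assoc, Matrix.mul_assoc,
      ← Matrix.mul_assoc (H k), ← hN k, ← Matrix.mul_assoc,
      Matrix.nonsing_inv_mul _ ((Matrix.isUnit_iff_isUnit_det _).1 hpd.isUnit), Matrix.one_mul]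
  refine ⟨lmmse H σ F, rateMatrix H σ F, _, 1, fun k => isLMMSEReceiver_lmmse H F k (hσ k),
    fun k => ⟨rateMatrix_posDef H F k (hσ k), rateMatrix_mul_mseMatrix H F k (hσ k)⟩, rfl, hβ,
    one_pos, hP, fun k => ?_, hpd, hsol⟩
  rw [Finset.sum_add_distrib, ← Finset.sum_smul, ← Complex.ofReal_sum]
  exact hsol k
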